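/- Let $(\mathcal M,g)$ be a closed oriented Riemannian spin manifold of even dimension $n=2m$, let $L^2(\mathcal M,S)$ be the Hilbert space of square integrable spinors, and let $\gamma^a$ $(a=0,\dots,2m-1)$ be selfadjoint Euclidean Dirac matrices of size $2^m$, $\gamma^a\gamma^b+\gamma^b\gamma^a=2\delta^{ab}$. Put $\gamma^\mu=e^\mu_a\gamma^a$ for an orthonormal frame $E_a=e_a^\mu\partial_\mu$, let $\gamma=-(-i)^m\gamma^0\cdots\gamma^{2m-1}$ be the grading, $\mathcal J$ the real structure (the antiunitary charge conjugation operator, anticommuting with the $\gamma^\mu$), and $\slashed\partial=-i\gamma^\mu\widetilde\nabla^S_\mu$ the Dirac operator (the closure of this operator on smooth spinors), where $\widetilde\nabla^S$ is the lift of the Levi-Civita connection to spinors. Assume that the $KO$-dimension, i.e. $n$ modulo $8$, is $0$ or $4$. The algebra $C^\infty(\mathcal M)\otimes\mathbb C^2$ acts on $L^2(\mathcal M,S)$ by $\pi(f,g)=\frac{1+\gamma}{2}f+\frac{1-\gamma}{2}g$, and carries the twist $\rho(f,g)=(g,f)$ and the twisted involution $a^+=\rho(a)^*$. For a smooth function $h':\mathcal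 M\to\mathbb C$ without zeros let $u_{h'}=(h',1/\overline{h'})$, which is a twisted unitary ($u^+u=uu^+=1$), and put $\mathrm{Ad}(u)=\pi(u)\,\mathcal J\pi(u)\mathcal J^{-1}$, a bounded operator with Hilbert space adjoint $\mathrm{Ad}(u)^\dagger$. For a smooth real $1$-form $\omega_f=f_\mu dx^\mu$ let $$\slashed\partial_{\omega_f}=\slashed\partial-if_\mu\gamma^\mu\gamma .$$ Then, as (unbounded) operators on $L^2(\mathcal M,S)$, domains included, $$\mathrm{Ad}(u_{h'})\,(-if_\mu\gamma^\mu\gamma)\,\mathrm{Ad}(u_{h'})^\dagger=-if_\mu\gamma^\mu\gamma ,\qquad \mathrm{Ad}(u_{h'})\,\slashed\partial_{\omega_f}\,\mathrm{Ad}(u_{h'})^\dagger=\slashed\partial_{\omega_f+d(\ln|h'|^2)} .$$ That is, the conjugate action of $u_{h'}$ leaves the torsion term invariant and amounts to mapping $\omega_f$ to $\omega_f+d(\ln|h'|^2)$. -/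

import Mathlib

open MeasureTheory Bundle
open scoped Manifold ContDiff ENNReal ComplexConjugate Matrix

noncomputable section

namespace TwistedSpin

/-! ### Dirac matrices, grading, charge conjugation -/

/-- The model space `ℝ^{2m}` of the manifold, with its Euclidean norm. -/
abbrev Model (m : ℕ) : Type := EuclideanSpace ℝ (Fin (2 * m))

/-- The spinor space `ℂ^{2^m}` with its Hermitian inner product. -/
abbrev SpinorSpace (m : ℕ) : Type := EuclideanSpace ℂ (Fin (2 ^ m))

/-- Square complex matrices of size `2^m`. -/
abbrev SpinMat (m : ℕ) : Type := Matrix (Fin (2 ^ m)) (Fin (2 ^ m)) ℂ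

/-- The bounded operator on the spinor space given by a matrix. -/
def act {m : ℕ} (A : SpinMat m) : SpinorSpace m →L[ℂ] SpinorSpace m :=
  Matrix.toEuclideanCLM (n := Fin (2 ^ m)) (𝕜 := ℂ) A

/-- A choice of Euclidean Dirac matrices in dimension `2m`: selfadjoint matrices `γ^0, …, γ^{2m-1}`
of size `2^m` with `γ^a γ^b + γ^b γ^a = 2 δ^{ab}`. -/
structure DiracMatrices (m : ℕ) where
  mat : Fin (2 * m) → SpinMat m
  isHermitian : ∀ a, (mat a)ᴴ = mat a
  anticomm : ∀ a b, mat a * mat b + mat b * mat a = if a = b then (2 : ℂ) • 1 else 0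

/-- The grading `γ = -(-i)^m γ^0 γ^1 ⋯ γ^{2m-1}`. -/
def DiracMatrices.grading {m : ℕ} (γ : DiracMatrices m) : SpinMat m :=
  (-(-Complex.I) ^ m) • (List.ofFn γ.mat).prod

/-- The projection `(1 + γ)/2` on the spinors of positive chirality. -/
def DiracMatrices.chiralPos {m : ℕ} (γ : DiracMatrices m) : SpinMat m :=
  (1 / 2 : ℂ) • (1 + γ.grading)

/-- The projection `(1 - γ)/2` on the spinors of negative chirality. -/
def DiracMatrices.chiralNeg {m : ℕ} (γ : DiracMatrices m) : SpinMat m :=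
  (1 / 2 : ℂ) • (1 - γ.grading)

/-- Clifford multiplication `v_a γ^a` by a vector of `ℝ^{2m}`. -/
def DiracMatrices.slash {m : ℕ} (γ : DiracMatrices m) (v : Model m) : SpinMat m :=
  ∑ a, (v a : ℂ) • γ.mat a

/-- The group `Spin(2m)` in the spin representation: products of an even number of unit vectors.
(The inverse of `v w` is `w v`, so that the monoid generated by these products is a group.) -/
def DiracMatrices.spinGroup {m : ℕ} (γ : DiracMatrices m) : Submonoid (SpinMat m) :=
  Submonoid.closure {A | ∃ v w : Model m, ‖v‖ = 1 ∧ ‖w‖ = 1 ∧ A = γ.slash v * γ.slash w}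

/-- A charge conjugation matrix: a unitary matrix `C` such that the antilinear map `ψ ↦ C ψ̄`
anticommutes with all the Dirac matrices. (By irreducibility, `C` is unique up to a phase.) -/
structure ChargeConjugation {m : ℕ} (γ : DiracMatrices m) where
  C : Matrix.unitaryGroup (Fin (2 ^ m)) ℂ
  anticomm : ∀ a, (C : SpinMat m) * (γ.mat a).map conj = -(γ.mat a * (C : SpinMat m))

/-- Componentwise complex conjugation of spinors. -/
def conjSpinor (m : ℕ) : SpinorSpace m ≃ₗᵢ⋆[ℂ] SpinorSpace m where
  toFun ψ := WithLp.toLp 2 fun i => conj (ψ i)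
  invFun ψ := WithLp.toLp 2 fun i => conj (ψ i)
  map_add' ψ φ := by ext i; simp
  map_smul' c ψ := by ext i; simp
  left_inv ψ := by ext i; simp
  right_inv ψ := by ext i; simp
  norm_map' ψ := by simp [EuclideanSpace.norm_eq]

/-- The antiunitary map `ψ ↦ C ψ̄` of the spinor space. -/
def ChargeConjugation.fibre {m : ℕ} {γ : DiracMatrices m} (c : ChargeConjugation γ) :
    SpinorSpace m ≃ₗᵢ⋆[ℂ] SpinorSpace m :=
  (conjSpinor m).trans (Unitary.linearIsometryEquiv
    ⟨act (c.C : SpinMat m), Unitary.map_mem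
      (Matrix.toEuclideanCLM (n := Fin (2 ^ m)) (𝕜 := ℂ)) c.C.2⟩)

/-- The `KO`-dimension of the spectral triple of a spin manifold of dimension `2m`. -/
def koDimension (m : ℕ) : ℕ := (2 * m) % 8

/-! ### The algebra of the minimal twist -/

section Algebra

variable {m : ℕ} {M : Type*} [TopologicalSpace M] [ChartedSpace (Model m) M]

/-- The algebra `C^∞(M)` of smooth complex functions on `M`. -/
abbrev SmoothFun (m : ℕ) (M : Type*) [TopologicalSpace M] [ChartedSpace (Model m) M] : Type _ :=
  C^∞⟮𝓡 (2 * m), M; 𝓘(ℝ, ℂ), ℂ⟯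

/-- The algebra `C^∞(M) ⊗ ℂ²`, that is pairs of smooth functions. -/
abbrev TwistAlgebra (m : ℕ) (M : Type*) [TopologicalSpace M] [ChartedSpace (Model m) M] : Type _ :=
  SmoothFun m M × SmoothFun m M

/-- The complex conjugate of a smooth function. -/
def conjFun (f : SmoothFun m M) : SmoothFun m M :=
  ⟨fun x => conj (f x), Complex.conjCLE.contDiff.contMDiff.comp f.contMDiff⟩

/-- The inverse of a smooth function without zeros. -/
def invFun (f : SmoothFun m M) (hf : ∀ x, f x ≠ 0) : SmoothFun m M :=
  ⟨fun x => (f x)⁻¹, fun x => ((contDiffAt_inv ℝ (hf x)).contMDiffAt).comp x (f.contMDiff x)⟩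

/-- The twist `ρ(f, g) = (g, f)`. -/
def flip (a : TwistAlgebra m M) : TwistAlgebra m M := (a.2, a.1)

/-- The involution `(f, g)^* = (f̄, ḡ)`. -/
def adj (a : TwistAlgebra m M) : TwistAlgebra m M := (conjFun a.1, conjFun a.2)

/-- The twisted involution `a⁺ = ρ(a)^*`. -/
def twistedAdj (a : TwistAlgebra m M) : TwistAlgebra m M := adj (flip a)

/-- The twisted unitaries: `u⁺ u = u u⁺ = 1`. -/
def IsTwistedUnitary (u : TwistAlgebra m M) : Prop :=
  ∀ x, ((twistedAdj u).1 x * u.1 x = 1 ∧ (twistedAdj u).2 x * u.2 x = 1) ∧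
    (u.1 x * (twistedAdj u).1 x = 1 ∧ u.2 x * (twistedAdj u).2 x = 1)

/-- The twisted unitary `u_h = (h, 1 / h̄)` of a smooth function `h` without zeros. -/
def twistedUnitary (h : SmoothFun m M) (hh : ∀ x, h x ≠ 0) :
    {u : TwistAlgebra m M // IsTwistedUnitary u} :=
  ⟨(h, invFun (conjFun h) fun x => (map_ne_zero (starRingEnd ℂ)).2 (hh x)), fun x => by
    have h1 : h x ≠ 0 := hh x
    have h2 : conj (h x) ≠ 0 := (map_ne_zero (starRingEnd ℂ)).2 h1
    have e1 : (invFun (conjFun h) fun x => (map_ne_zero (starRingEnd ℂ)).2 (hh x)) x =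
      (conj (h x))⁻¹ := rfl
    have e2 : ∀ (f : SmoothFun m M), conjFun f x = conj (f x) := fun _ => rfl
    simp [twistedAdj, adj, flip, e1, e2, h1]⟩

/-- The endomorphism `(1 + γ)/2 f + (1 - γ)/2 g` of the spinors by which `(f, g)` acts. -/
def symbol (γ : DiracMatrices m) (a : TwistAlgebra m M) (x : M) :
    SpinorSpace m →L[ℂ] SpinorSpace m :=
  a.1 x • act γ.chiralPos + a.2 x • act γ.chiralNeg

theorem memLp_symbol [CompactSpace M] [MeasurableSpace M] [BorelSpace M] (γ : DiracMatrices m)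
    (a : TwistAlgebra m M) (μ : Measure M) :
    MemLp (symbol γ a) ∞ μ := by
  have hc : Continuous (symbol γ a) :=
    (a.1.contMDiff.continuous.smul continuous_const).add
      (a.2.contMDiff.continuous.smul continuous_const)
  obtain ⟨K, hK⟩ := (isCompact_range hc).isBounded.exists_norm_le
  exact memLp_top_of_bound hc.aestronglyMeasurable K
    (Filter.Eventually.of_forall fun x => hK _ ⟨x, rfl⟩)

end Algebra

/-! ### Riemannian manifolds and spin structures -/

section Manifold

variable {m : ℕ} {M : Type*} [TopologicalSpace M] [ChartedSpace (Model m) M]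
  [IsManifold (𝓡 (2 * m)) ∞ M]

/-- Smooth Riemannian metrics on `M`. -/
abbrev Metric (m : ℕ) (M : Type*) [TopologicalSpace M] [ChartedSpace (Model m) M]
    [IsManifold (𝓡 (2 * m)) ∞ M] : Type _ :=
  ContMDiffRiemannianMetric (𝓡 (2 * m)) ∞ (Model m) (fun x : M => TangentSpace (𝓡 (2 * m)) x)

/-- A spin structure on the Riemannian manifold `(M, g)`, given by its cocycle: a countable cover of
`M` by chart domains `U_k`, on each `U_k` a smooth orthonormal frame `E^k_a`, and on the overlaps
`U_k ∩ U_l` smooth functions `s_{kl}` with values in `Spin(2m)`, subject to the cocycle condition,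
which lift the transition functions of the frames,
`s_{kl} γ^b s_{kl}⁻¹ = g(E^k_a, E^l_b) γ^a`. As the transition functions of the frames lie in
the image `SO(2m)` of `Spin(2m)`, the frames define the orientation of `M`. -/
structure SpinStructure (g : Metric m M) (γ : DiracMatrices m) where
  chart : ℕ → OpenPartialHomeomorph M (Model m)
  chart_mem : ∀ k, chart k ∈ IsManifold.maximalAtlas (𝓡 (2 * m)) ∞ M
  cover : ∀ x, ∃ k, x ∈ (chart k).source
  frame : ℕ → Fin (2 * m) → ∀ x : M, TangentSpace (𝓡 (2 * m)) x
  frame_smooth : ∀ k a, ContMDiffOn (𝓡 (2 * m)) (𝓡 (2 * m)).tangent ∞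
    (fun x => (⟨x, frame k a x⟩ : TangentBundle (𝓡 (2 * m)) M)) (chart k).source
  frame_orthonormal : ∀ k a b, ∀ x ∈ (chart k).source,
    g.inner x (frame k a x) (frame k b x) = if a = b then 1 else 0
  trans : ℕ → ℕ → M → SpinMat m
  trans_smooth : ∀ k l p q, ContMDiffOn (𝓡 (2 * m)) 𝓘(ℝ, ℂ) ∞
    (fun x => trans k l x p q) ((chart k).source ∩ (chart l).source)
  trans_mem : ∀ k l, ∀ x ∈ (chart k).source ∩ (chart l).source, trans k l x ∈ γ.spinGroup
  trans_lift : ∀ k l b, ∀ x ∈ (chart k).source ∩ (chart l).source,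
    trans k l x * γ.mat b =
      (∑ a, (g.inner x (frame k a x) (frame l b x) : ℂ) • γ.mat a) * trans k l x
  trans_cocycle : ∀ k l j, ∀ x ∈ (chart k).source ∩ (chart l).source ∩ (chart j).source,
    trans k l x * trans l j x = trans k j x

/-- Smooth real `1`-forms on `M`. -/
def IsSmoothForm (ωf : ∀ x : M, TangentSpace (𝓡 (2 * m)) x →L[ℝ] ℝ) : Prop :=
  ContMDiff (𝓡 (2 * m)) ((𝓡 (2 * m)).prod 𝓘(ℝ, Model m →L[ℝ] ℝ)) ∞
    (fun x => TotalSpace.mk' (Model m →L[ℝ] ℝ) (E := fun x : M =>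
      TangentSpace (𝓡 (2 * m)) x →L[ℝ] ℝ) x (ωf x))

/-- The differential `df` of a real function on `M`, as a `1`-form. -/
def differential (f : M → ℝ) (x : M) : TangentSpace (𝓡 (2 * m)) x →L[ℝ] ℝ :=
  mvfderiv (𝓡 (2 * m)) f x

namespace SpinStructure

variable {g : Metric m M} {γ : DiracMatrices m} (S : SpinStructure g γ)

open Classical in
/-- The first index `k` with `x ∈ U_k`. Spinor fields are recorded by their components in the
spin frame over `U_{idx x}`, which is a measurable trivialisation of the spinor bundle. -/
def idx (x : M) : ℕ := Nat.find (S.cover x)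

/-- A spinor field, that is a section of the vector bundle with fibre `ℂ^{2^m}` and transition
functions `s_{kl}`, given at each point `x` by its components in the spin frame of `U_{idx x}`. -/
abbrev SpinorField (_S : SpinStructure g γ) : Type _ := M → SpinorSpace m

/-- The components, over `U_k`, of a spinor field in the spin frame of `U_k`. -/
def localRep (k : ℕ) (ψ : S.SpinorField) (y : M) : SpinorSpace m :=
  act (S.trans k (S.idx y) y) (ψ y)

/-- A spinor field is smooth if its components in all the spin frames are. -/
def IsSmooth (ψ : S.SpinorField) : Prop :=
  ∀ k, ContMDiffOn (𝓡 (2 * m)) 𝓘(ℝ, SpinorSpace m) ∞ (S.localRep k ψ) (S.chart k).source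

/-- `g([E_a, E_b], E_c)` for the frame over `U_k`. -/
def bracketCoeff (k : ℕ) (x : M) (a b c : Fin (2 * m)) : ℝ :=
  g.inner x (VectorField.mlieBracket (𝓡 (2 * m)) (S.frame k a) (S.frame k b) x) (S.frame k c x)

/-- The components `Γ_{abc} = g(∇_{E_a} E_b, E_c)` of the Levi-Civita connection in the orthonormal
frame over `U_k`, by Koszul's formula. -/
def leviCivita (k : ℕ) (x : M) (a b c : Fin (2 * m)) : ℝ :=
  (1 / 2) * (S.bracketCoeff k x a b c - S.bracketCoeff k x b c a + S.bracketCoeff k x c a b)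

/-- The connection matrix `¼ Γ_{abc} γ^c γ^b` of the lift of the Levi-Civita connection to
spinors, in the direction `E_a` and in the spin frame over `U_k`. With `(γ^a)² = 1` this is the
normalisation for which `[∇^S_X, c(Y)] = c(∇_X Y)`. -/
def spinConnection (k : ℕ) (x : M) (a : Fin (2 * m)) : SpinMat m :=
  (1 / 4 : ℂ) • ∑ b, ∑ c, (S.leviCivita k x a b c : ℂ) • (γ.mat c * γ.mat b)

/-- The covariant derivative `∇^S_{E_a} ψ` at `x`, for `E_a` and the components taken in the
frame of `U_{idx x}`. -/
def spinDeriv (ψ : S.SpinorField) (x : M) (a : Fin (2 * m)) : SpinorSpace m :=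
  mvfderiv (𝓡 (2 * m)) (S.localRep (S.idx x) ψ) x (S.frame (S.idx x) a x) +
    act (S.spinConnection (S.idx x) x a) (ψ x)

/-- The Dirac operator `∂̸ = -i γ^a ∇^S_{E_a}` as a differential operator on spinor fields. -/
def dirac (ψ : S.SpinorField) : S.SpinorField := fun x =>
  (-Complex.I) • ∑ a, act (γ.mat a) (S.spinDeriv ψ x a)

/-- The torsion term `-i f_μ γ^μ γ` of the `1`-form `ω_f = f_μ dx^μ`, acting pointwise on spinor
fields (in the orthonormal frame, `f_a = ω_f(E_a)`). -/
def torsionTerm (ωf : ∀ x : M, TangentSpace (𝓡 (2 * m)) x →L[ℝ] ℝ) (ψ : S.SpinorField) :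
    S.SpinorField := fun x =>
  (-Complex.I) • ∑ a, (ωf x (S.frame (S.idx x) a x) : ℂ) • act (γ.mat a * γ.grading) (ψ x)

/-- The twisted covariant Dirac operator `∂̸_{ω_f} = ∂̸ - i f_μ γ^μ γ` on spinor fields. -/
def twistedDirac (ωf : ∀ x : M, TangentSpace (𝓡 (2 * m)) x →L[ℝ] ℝ) (ψ : S.SpinorField) :
    S.SpinorField := fun x => S.dirac ψ x + S.torsionTerm ωf ψ x

/-! ### The Hilbert space of square integrable spinors -/

/-- The matrix `g(∂_i, ∂_j)` of the metric in the chart of `U_k`, at the point with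
coordinates `y`. -/
def gram (k : ℕ) (y : Model m) : Matrix (Fin (2 * m)) (Fin (2 * m)) ℝ := fun i j =>
  g.inner ((S.chart k).symm y)
    (mfderiv 𝓘(ℝ, Model m) (𝓡 (2 * m)) (S.chart k).symm y (EuclideanSpace.single i (1 : ℝ)))
    (mfderiv 𝓘(ℝ, Model m) (𝓡 (2 * m)) (S.chart k).symm y (EuclideanSpace.single j (1 : ℝ)))

variable [MeasurableSpace M]

/-- The Riemannian measure on `U_k`: the image of `√(det g) dy` by the inverse of the chart. -/
def chartMeasure (k : ℕ) : Measure M :=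
  ((volume.restrict (S.chart k).target).withDensity
    fun y => ENNReal.ofReal (Real.sqrt (S.gram k y).det)).map (S.chart k).symm

/-- The Riemannian measure of `M`, glued from the disjoint pieces `{x | idx x = k} ⊆ U_k`. -/
def vol : Measure M :=
  Measure.sum fun k => (S.chartMeasure k).restrict {x | S.idx x = k}

/-- The Hilbert space `L²(M, S)` of square integrable spinors. The pointwise norm of a spinor
does not depend on the spin frame, because the transition functions are unitary. -/
abbrev L2 : Type _ := Lp (SpinorSpace m) 2 S.vol

/-- The closed operator on `L²(M, S)` defined by an operator `P` on spinor fields: the closure of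
`P` on the domain of all smooth spinors `ψ` (with `P ψ` square integrable). The span is only there
to have a subspace; for a linear `P` the set is one already. -/
def realize (P : S.SpinorField → S.SpinorField) : S.L2 →ₗ.[ℂ] S.L2 :=
  (Submodule.span ℂ {p : S.L2 × S.L2 | ∃ ψ : S.SpinorField, S.IsSmooth ψ ∧
    p.1 =ᵐ[S.vol] ψ ∧ p.2 =ᵐ[S.vol] P ψ}).topologicalClosure.toLinearPMap

/-- The antilinear operator on `L²(M, S)` given by an antilinear map of the spinor space. -/
def antilinearOp (L : SpinorSpace m ≃ₗᵢ⋆[ℂ] SpinorSpace m) : S.L2 →SL[starRingEnd ℂ] S.L2 :=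
  (L.toContinuousLinearEquiv : SpinorSpace m →SL[starRingEnd ℂ] SpinorSpace m).compLpL 2 S.vol

theorem antilinearOp_symm (L : SpinorSpace m ≃ₗᵢ⋆[ℂ] SpinorSpace m) (ψ : S.L2) :
    S.antilinearOp L.symm (S.antilinearOp L ψ) = ψ := by
  ext1
  filter_upwards [ContinuousLinearMap.coeFn_compLpL (p := 2) (μ := S.vol)
      (L.toContinuousLinearEquiv : SpinorSpace m →SL[starRingEnd ℂ] SpinorSpace m) ψ,
    ContinuousLinearMap.coeFn_compLpL (p := 2) (μ := S.vol)
      (L.symm.toContinuousLinearEquiv : SpinorSpace m →SL[starRingEnd ℂ] SpinorSpace m)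
      (S.antilinearOp L ψ)] with x h1 h2
  unfold antilinearOp at h2 ⊢
  rw [h2, h1]
  simp

/-- The real structure `𝒥 ψ = C ψ̄` on `L²(M, S)`. -/
def realStructure (c : ChargeConjugation γ) : S.L2 ≃SL[starRingEnd ℂ] S.L2 :=
  ContinuousLinearEquiv.equivOfInverse (S.antilinearOp c.fibre) (S.antilinearOp c.fibre.symm)
    (S.antilinearOp_symm c.fibre) (S.antilinearOp_symm c.fibre.symm)

end SpinStructure

namespace SpinStructure

variable {g : Metric m M} {γ : DiracMatrices m} (S : SpinStructure g γ)

variable [CompactSpace M] [MeasurableSpace M] [BorelSpace M]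

/-- The representation `π(f, g)` of `C^∞(M) ⊗ ℂ²` on `L²(M, S)`: multiplication by `f` on the
spinors of positive chirality and by `g` on those of negative chirality. -/
def rep (a : TwistAlgebra m M) : S.L2 →L[ℂ] S.L2 :=
  (ContinuousLinearMap.id ℂ (SpinorSpace m →L[ℂ] SpinorSpace m)).holderL S.vol ∞ 2 2
    ((memLp_symbol γ a S.vol).toLp _)

/-- The adjoint action `Ad(u) = u 𝒥 u 𝒥⁻¹`. -/
def Ad (c : ChargeConjugation γ) (u : TwistAlgebra m M) : S.L2 →L[ℂ] S.L2 :=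
  (S.rep u).comp ((S.realStructure c : S.L2 →SL[starRingEnd ℂ] S.L2).comp
    ((S.rep u).comp ((S.realStructure c).symm : S.L2 →SL[starRingEnd ℂ] S.L2)))

end SpinStructure

/-- The conjugate action `D ↦ T D T†` of a bounded operator `T` on an unbounded operator `D` of a
Hilbert space, on its natural domain `{ψ | T† ψ ∈ dom D}`. -/
def conjugateAction {H : Type*} [NormedAddCommGroup H] [InnerProductSpace ℂ H] [CompleteSpace H]
    (T : H →L[ℂ] H) (D : H →ₗ.[ℂ] H) : H →ₗ.[ℂ] H where
  domain := D.domain.comap (ContinuousLinearMap.adjoint T : H →ₗ[ℂ] H)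
  toFun := (T : H →ₗ[ℂ] H) ∘ₗ D.toFun ∘ₗ
    (ContinuousLinearMap.adjoint T : H →ₗ[ℂ] H).submoduleComap D.domain

end Manifold

end TwistedSpin

end

/-!
The operator `T = Ad(u_h)` is multiplication by an endomorphism of the spinor bundle. In
`KO`-dimension `0` or `4` the integer `m` is even, so that the real structure commutes with the
grading `γ` (`ChargeConjugation.mul_map_grading`), and therefore
`T = k (1 + γ)/2 + k⁻¹ (1 - γ)/2` with `k = |h|²` (`SpinStructure.coeFn_Ad`). As `γ` is a selfadjoint
involution, `T` is selfadjoint, and it is invertible, with inverse `Ad(u_{1/h})`.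

Each `γ^a` anticommutes with `γ`, hence `T γ^a = γ^a T⁻¹`. This gives
`T γ^a γ T = γ^a T⁻¹ γ T = γ^a γ`, the invariance of the torsion term
(`SpinStructure.rescale_torsionTerm_rescale`). For the Dirac operator the same exchange gives
`T γ^a ∇_a T = γ^a T⁻¹ ∇_a T`. The matrices of the spin connection and of the spin group are even in
the Dirac matrices, so they commute with `T`, and the Leibniz rule with `d(k⁻¹) = -k⁻¹ d(ln k)` gives
`T⁻¹ ∇_a T = ∇_a + E_a(ln k) γ` (`SpinStructure.spinDeriv_rescale`). The extra term is the torsion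
term of `d(ln k)` (`SpinStructure.rescale_twistedDirac_rescale`).

These are identities of differential operators on smooth spinors, and `T` maps the smooth spinors
bijectively to themselves. The homeomorphism `(x, y) ↦ (T⁻¹ x, T y)` of `L² × L²` thus carries the
graph of one differential operator to that of the other, hence also the closures of the graphs,
which is the equality of the closed operators, domains included
(`SpinStructure.conjugateAction_realize`).
-/

noncomputable section

namespace TwistedSpin

/-! ### Products of anticommuting involutions -/

section Anticommuting

variable {R : Type*} [Ring R]

theorem list_prod_mul_of_anticomm (b : R) (l : List R) (hl : ∀ x ∈ l, b * x = -(x * b)) :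
    l.prod * b = (-1) ^ l.length * (b * l.prod) := by
  induction l with
  | nil => simp
  | cons x l ih =>
    have h1 := ih fun y hy => hl y (List.mem_cons_of_mem _ hy)
    have h2 : x * b = -(b * x) := by rw [hl x List.mem_cons_self, neg_neg]
    have h3 : x * ((-1) ^ l.length * (b * l.prod)) = (-1) ^ l.length * (x * b * l.prod) := by
      rw [← mul_assoc, ← ((Commute.neg_one_left x).pow_left _).eq]; simp [mul_assoc]
    rw [List.prod_cons, mul_assoc, h1, h3, h2, List.length_cons, pow_succ]
    simp [mul_assoc]

theorem list_prod_mul_reverse_prod (l : List R) (hl : ∀ x ∈ l, x * x = 1) :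
    l.prod * l.reverse.prod = 1 := by
  induction l with
  | nil => simp
  | cons x l ih =>
    have h1 := ih fun y hy => hl y (List.mem_cons_of_mem _ hy)
    simp only [List.prod_cons, List.reverse_cons, List.prod_append, List.prod_nil, mul_one]
    rw [mul_assoc, ← mul_assoc l.prod, h1, one_mul, hl x List.mem_cons_self]

/-- Reversing a product of `n` anticommuting factors costs the sign of the order-reversing
permutation, whose number of inversions is `n.choose 2`. -/
theorem list_reverse_prod_of_anticomm (l : List R)
    (hl : l.Pairwise fun x y => x * y = -(y * x)) :
    l.reverse.prod = (-1) ^ l.length.choose 2 * l.prod := by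
  induction l with
  | nil => simp
  | cons x l ih =>
    obtain ⟨h1, h2⟩ := List.pairwise_cons.1 hl
    simp only [List.prod_cons, List.reverse_cons, List.prod_append, List.prod_nil, mul_one,
      List.length_cons]
    rw [ih h2, mul_assoc, list_prod_mul_of_anticomm x l h1, ← mul_assoc, ← pow_add,
      Nat.choose_succ_succ' l.length 1, Nat.choose_one_right, Nat.add_comm]

/-- The product of an even number of anticommuting elements anticommutes with each of them: a
factor passes all the others, which are odd in number. -/
theorem list_prod_anticomm_of_mem {l : List R} (hl : l.Pairwise fun x y => x * y = -(y * x))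
    (he : Even l.length) {b : R} (hb : b ∈ l) : l.prod * b = -(b * l.prod) := by
  obtain ⟨s, t, rfl⟩ := List.append_of_mem hb
  obtain ⟨-, h2, h3⟩ := List.pairwise_append.1 hl
  obtain ⟨h4, -⟩ := List.pairwise_cons.1 h2
  have hs := list_prod_mul_of_anticomm b s fun x hx => by
    rw [h3 x hx b List.mem_cons_self, neg_neg]
  have ht := list_prod_mul_of_anticomm b t h4
  simp only [List.prod_append, List.prod_cons]
  -- Both sides are signs times `s.prod * b * b * t.prod`, the signs counting the factors passed.
  have e1 : s.prod * (b * t.prod) * b = (-1) ^ t.length * (s.prod * b * (b * t.prod)) := by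
    rw [mul_assoc, mul_assoc b, ht, ← mul_assoc b, ← ((Commute.neg_one_left b).pow_left _).eq,
      mul_assoc _ b, ← mul_assoc s.prod, ← ((Commute.neg_one_left s.prod).pow_left _).eq]
    simp only [mul_assoc]
  have e2 : b * (s.prod * (b * t.prod)) = (-1) ^ s.length * (s.prod * b * (b * t.prod)) := by
    rw [hs, ← mul_assoc b]
    simp only [← mul_assoc]
    rw [← pow_add, Even.neg_one_pow ⟨s.length, rfl⟩, one_mul]
  rw [e1, e2]
  have h5 : Odd (s.length + t.length) := by
    rw [List.length_append, List.length_cons] at he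
    rcases Nat.even_or_odd (s.length + t.length) with h | h
    · exact absurd he (by rw [← add_assoc, Nat.even_add_one]; exact not_not.2 h)
    · exact h
  rcases Nat.even_or_odd s.length with h | h
  · rw [h.neg_one_pow, (Nat.odd_add.1 h5 |>.not.1 (by simpa using h) |>
      Nat.not_even_iff_odd.1).neg_one_pow]
    simp
  · rw [h.neg_one_pow, (Nat.odd_add.1 h5 |>.1 h).neg_one_pow]
    simp

end Anticommuting

/-! ### The grading -/

namespace DiracMatrices

variable {m : ℕ} (γ : DiracMatrices m)

theorem mat_mul_self (a : Fin (2 * m)) : γ.mat a * γ.mat a = 1 := by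
  have h := γ.anticomm a a
  rw [if_pos rfl, ← two_smul ℂ] at h
  exact smul_right_injective _ (two_ne_zero (α := ℂ)) h

theorem pairwise_anticomm :
    (List.ofFn γ.mat).Pairwise fun x y => x * y = -(y * x) := by
  rw [List.pairwise_ofFn]
  intro i j hij
  have h := γ.anticomm i j
  rw [if_neg hij.ne] at h
  exact eq_neg_of_add_eq_zero_left h

theorem conjTranspose_list_prod (l : List (SpinMat m)) (hl : ∀ x ∈ l, xᴴ = x) :
    l.prodᴴ = l.reverse.prod := by
  rw [Matrix.conjTranspose_list_prod, List.map_congr_left hl, List.map_id']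

theorem reverse_prod :
    (List.ofFn γ.mat).reverse.prod = (-1) ^ m * (List.ofFn γ.mat).prod := by
  rw [list_reverse_prod_of_anticomm _ γ.pairwise_anticomm, List.length_ofFn]
  have h : (2 * m).choose 2 = m * (2 * m - 1) := by
    rw [Nat.choose_two_right, mul_assoc, Nat.mul_div_cancel_left _ two_pos]
  rw [h]
  rcases Nat.even_or_odd m with hm | hm
  · rw [hm.neg_one_pow, (hm.mul_right _).neg_one_pow]
  · rw [hm.neg_one_pow, (hm.mul (by obtain ⟨k, rfl⟩ := hm; exact ⟨2 * k, by omega⟩)).neg_one_pow]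

theorem grading_mul_self : γ.grading * γ.grading = 1 := by
  have h1 : (List.ofFn γ.mat).prod * (List.ofFn γ.mat).reverse.prod = 1 :=
    list_prod_mul_reverse_prod _ fun x hx => by
      obtain ⟨a, rfl⟩ := List.mem_ofFn.1 hx
      exact γ.mat_mul_self a
  have h2 : (List.ofFn γ.mat).prod * (List.ofFn γ.mat).prod = ((-1) ^ m : ℂ) • 1 := by
    rw [γ.reverse_prod] at h1
    rcases Nat.even_or_odd m with hm | hm
    · simpa [hm.neg_one_pow] using h1
    · simpa [hm.neg_one_pow, neg_eq_iff_eq_neg] using h1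
  rw [grading, smul_mul_smul_comm, h2, smul_smul, neg_mul_neg, ← mul_pow, ← mul_pow]
  simp

theorem conjTranspose_grading : γ.gradingᴴ = γ.grading := by
  have h : (List.ofFn γ.mat).prodᴴ = (List.ofFn γ.mat).reverse.prod :=
    conjTranspose_list_prod _ fun x hx => by
      obtain ⟨a, rfl⟩ := List.mem_ofFn.1 hx
      exact γ.isHermitian a
  rw [grading, Matrix.conjTranspose_smul, h, γ.reverse_prod]
  rcases Nat.even_or_odd m with hm | hm <;> simp [hm.neg_one_pow, hm.neg_pow]

theorem grading_mul_mat (a : Fin (2 * m)) : γ.grading * γ.mat a = -(γ.mat a * γ.grading) := by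
  rw [grading, smul_mul_assoc, list_prod_anticomm_of_mem γ.pairwise_anticomm (by simp)
    (List.mem_ofFn.2 ⟨a, rfl⟩), mul_smul_comm, smul_neg]

theorem commute_grading_mat_mul_mat (a b : Fin (2 * m)) :
    Commute γ.grading (γ.mat a * γ.mat b) := by
  rw [commute_iff_eq, ← mul_assoc, grading_mul_mat, neg_mul, mul_assoc, grading_mul_mat]
  simp [mul_assoc]

theorem grading_mul_slash (v : Model m) : γ.grading * γ.slash v = -(γ.slash v * γ.grading) := by
  simp only [slash, Finset.mul_sum, Finset.sum_mul, ← Finset.sum_neg_distrib, mul_smul_comm,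
    smul_mul_assoc, grading_mul_mat, smul_neg]

/-- The Clifford relation `(v_a γ^a)² = ‖v‖²`. The proof adds the two expansions of the square that
differ by the order of the indices. -/
theorem slash_mul_slash_self (v : Model m) : γ.slash v * γ.slash v = ((‖v‖ ^ 2 : ℝ) : ℂ) • 1 := by
  have h : (2 : ℂ) • (γ.slash v * γ.slash v) = (2 : ℂ) • (((‖v‖ ^ 2 : ℝ) : ℂ) • 1) := by
    have e : γ.slash v * γ.slash v =
        ∑ a, ∑ b, ((v a : ℂ) * v b) • (γ.mat a * γ.mat b) := by
      simp only [slash, Finset.sum_mul_sum, smul_mul_smul_comm]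
    have e' : γ.slash v * γ.slash v =
        ∑ a, ∑ b, ((v a : ℂ) * v b) • (γ.mat b * γ.mat a) := by
      rw [e, Finset.sum_comm]
      simp only [mul_comm]
    rw [two_smul]
    nth_rewrite 1 [e]
    rw [e', EuclideanSpace.norm_sq_eq]
    simp only [← Finset.sum_add_distrib, ← smul_add, γ.anticomm, smul_ite, smul_zero,
      Finset.sum_ite_eq, Finset.mem_univ, if_true, Real.norm_eq_abs, sq_abs, Complex.ofReal_sum,
      Complex.ofReal_pow, Finset.sum_smul, Finset.smul_sum]
    exact Finset.sum_congr rfl fun a _ => by simp only [smul_smul]; ring_nf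
  exact smul_right_injective _ (two_ne_zero (α := ℂ)) h

theorem commute_grading_of_mem_spinGroup {A : SpinMat m} (hA : A ∈ γ.spinGroup) :
    Commute γ.grading A := by
  induction hA using Submonoid.closure_induction with
  | mem A h =>
    obtain ⟨v, w, -, -, rfl⟩ := h
    rw [commute_iff_eq, ← mul_assoc, grading_mul_slash, neg_mul, mul_assoc, grading_mul_slash]
    simp [mul_assoc]
  | one => exact Commute.one_right _
  | mul A B _ _ h1 h2 => exact h1.mul_right h2

theorem isUnit_of_mem_spinGroup {A : SpinMat m} (hA : A ∈ γ.spinGroup) : IsUnit A := by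
  have key : ∀ v : Model m, ‖v‖ = 1 → IsUnit (γ.slash v) := fun v hv => by
    have h := γ.slash_mul_slash_self v
    simp only [hv, one_pow, Complex.ofReal_one, one_smul] at h
    exact ⟨⟨_, _, h, h⟩, rfl⟩
  induction hA using Submonoid.closure_induction with
  | mem A h =>
    obtain ⟨v, w, hv, hw, rfl⟩ := h
    exact (key v hv).mul (key w hw)
  | one => exact isUnit_one
  | mul A B _ _ h1 h2 => exact h1.mul h2

end DiracMatrices

theorem ChargeConjugation.mul_map_list_prod {m : ℕ} {γ : DiracMatrices m}
    (c : ChargeConjugation γ) (l : List (SpinMat m)) (hl : ∀ x ∈ l, ∃ a, γ.mat a = x) :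
    (c.C : SpinMat m) * l.prod.map conj = ((-1 : ℂ) ^ l.length) • (l.prod * (c.C : SpinMat m)) := by
  induction l with
  | nil => simp [Matrix.map_one]
  | cons x l ih =>
    obtain ⟨a, rfl⟩ := hl x List.mem_cons_self
    rw [List.prod_cons, Matrix.map_mul, ← mul_assoc, c.anticomm, neg_mul, mul_assoc,
      ih fun y hy => hl y (List.mem_cons_of_mem _ hy), List.length_cons, pow_succ]
    simp [mul_assoc]

/-- In `KO`-dimension `0` or `4` the real structure commutes with the grading: the phase
`(-i)^m` is then real, and the grading is a product of an even number of Dirac matrices. -/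
theorem ChargeConjugation.mul_map_grading {m : ℕ} {γ : DiracMatrices m}
    (c : ChargeConjugation γ) (hm : Even m) :
    (c.C : SpinMat m) * γ.grading.map conj = γ.grading * (c.C : SpinMat m) := by
  have h1 := c.mul_map_list_prod (List.ofFn γ.mat) fun x hx => List.mem_ofFn.1 hx
  rw [List.length_ofFn, (even_two_mul m).neg_one_pow, one_smul] at h1
  have h2 : γ.grading.map conj =
      (-(-Complex.I) ^ m) • (List.ofFn γ.mat).prod.map conj := by
    ext i j
    simp [DiracMatrices.grading, hm.neg_pow]
  rw [h2, mul_smul_comm, h1, DiracMatrices.grading, smul_mul_assoc]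

/-! ### Rescaling of the two chiralities -/

section Act

variable {m : ℕ}

theorem act_mul_apply (A B : SpinMat m) (v : SpinorSpace m) : act (A * B) v = act A (act B v) := by
  simp [act, map_mul]

theorem act_one_apply (v : SpinorSpace m) : act (1 : SpinMat m) v = v := by
  simp [act]

theorem inner_act_left (A : SpinMat m) (v w : SpinorSpace m) :
    inner ℂ (act A v) w = inner ℂ v (act Aᴴ w) := by
  have h : act Aᴴ = ContinuousLinearMap.adjoint (act A) := by
    rw [← ContinuousLinearMap.star_eq_adjoint, act, act, ← map_star, Matrix.star_eq_conjTranspose]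
  rw [h, ContinuousLinearMap.adjoint_inner_right]

theorem conjSpinor_act (A : SpinMat m) (v : SpinorSpace m) :
    conjSpinor m (act A v) = act (A.map conj) (conjSpinor m v) := by
  ext i
  simp [act, conjSpinor, Matrix.mulVec, dotProduct]

end Act

namespace DiracMatrices

variable {m : ℕ} (γ : DiracMatrices m)

theorem act_grading_grading (v : SpinorSpace m) : act γ.grading (act γ.grading v) = v := by
  rw [← act_mul_apply, grading_mul_self, act_one_apply]

theorem act_chiralPos (v : SpinorSpace m) :
    act γ.chiralPos v = (1 / 2 : ℂ) • (v + act γ.grading v) := by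
  simp [act, chiralPos, map_add, map_smul]

theorem act_chiralNeg (v : SpinorSpace m) :
    act γ.chiralNeg v = (1 / 2 : ℂ) • (v - act γ.grading v) := by
  simp [act, chiralNeg, map_sub, map_smul]

/-- The endomorphism `t (1 + γ)/2 + t⁻¹ (1 - γ)/2` of the spinor space. -/
def chiralScale (t : ℝ) : SpinorSpace m →L[ℂ] SpinorSpace m :=
  (t : ℂ) • act γ.chiralPos + (t : ℂ)⁻¹ • act γ.chiralNeg

theorem chiralScale_apply (t : ℝ) (v : SpinorSpace m) :
    γ.chiralScale t v = (t : ℂ) • (1 / 2 : ℂ) • (v + act γ.grading v) +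
      (t : ℂ)⁻¹ • (1 / 2 : ℂ) • (v - act γ.grading v) := by
  simp [chiralScale, act_chiralPos, act_chiralNeg]

theorem chiralScale_inv_apply {t : ℝ} (ht : t ≠ 0) (v : SpinorSpace m) :
    γ.chiralScale t (γ.chiralScale t⁻¹ v) = v := by
  have ht' : (t : ℂ) ≠ 0 := Complex.ofReal_ne_zero.2 ht
  simp only [chiralScale_apply, map_add, map_sub, map_smul, act_grading_grading,
    Complex.ofReal_inv]
  match_scalars <;> field_simp <;> ring

theorem chiralScale_inv_apply' {t : ℝ} (ht : t ≠ 0) (v : SpinorSpace m) :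
    γ.chiralScale t⁻¹ (γ.chiralScale t v) = v := by
  simpa using γ.chiralScale_inv_apply (inv_ne_zero ht) v

theorem chiralScale_act_of_commute {A : SpinMat m} (hA : Commute γ.grading A) (t : ℝ)
    (v : SpinorSpace m) : γ.chiralScale t (act A v) = act A (γ.chiralScale t v) := by
  have h : act γ.grading (act A v) = act A (act γ.grading v) := by
    rw [← act_mul_apply, ← act_mul_apply, hA.eq]
  simp only [chiralScale_apply, h, map_add, map_sub, map_smul]

/-- A Dirac matrix exchanges the chiralities. -/
theorem chiralScale_act_mat (a : Fin (2 * m)) (t : ℝ) (v : SpinorSpace m) :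
    γ.chiralScale t (act (γ.mat a) v) = act (γ.mat a) (γ.chiralScale t⁻¹ v) := by
  have h : act γ.grading (act (γ.mat a) v) = -act (γ.mat a) (act γ.grading v) := by
    rw [← act_mul_apply, grading_mul_mat, ← act_mul_apply]
    simp [act]
  simp only [chiralScale_apply, h, map_add, map_sub, map_smul, Complex.ofReal_inv, inv_inv]
  module

theorem inner_chiralScale_left (t : ℝ) (v w : SpinorSpace m) :
    inner ℂ (γ.chiralScale t v) w = inner ℂ v (γ.chiralScale t w) := by
  have h : inner ℂ (act γ.grading v) w = inner ℂ v (act γ.grading w) := by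
    rw [inner_act_left, conjTranspose_grading]
  simp only [chiralScale_apply, inner_add_left, inner_add_right, inner_smul_left,
    inner_smul_right, inner_sub_left, inner_sub_right, h, map_inv₀, Complex.conj_ofReal,
    map_div₀, map_one, Complex.conj_ofNat]

end DiracMatrices

/-- Pointwise form of `Ad(u_h) = |h|² (1 + γ)/2 + |h|⁻² (1 - γ)/2`. -/
theorem ChargeConjugation.symbol_fibre_symbol {m : ℕ} {M : Type*} [TopologicalSpace M]
    [ChartedSpace (Model m) M] {γ : DiracMatrices m} (c : ChargeConjugation γ) (hm : Even m)
    (h : SmoothFun m M) (hh : ∀ x, h x ≠ 0) (x : M) (v : SpinorSpace m) :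
    symbol γ (twistedUnitary h hh).1 x
        (c.fibre (symbol γ (twistedUnitary h hh).1 x (c.fibre.symm v))) =
      γ.chiralScale (‖h x‖ ^ 2) v := by
  have hf : ∀ w, c.fibre w = act (c.C : SpinMat m) (conjSpinor m w) := fun w => rfl
  have hg : ∀ w, c.fibre (act γ.grading w) = act γ.grading (c.fibre w) := fun w => by
    rw [hf, hf, conjSpinor_act, ← act_mul_apply, ← act_mul_apply, c.mul_map_grading hm]
  have hs : ∀ w, symbol γ (twistedUnitary h hh).1 x w =
      h x • (1 / 2 : ℂ) • (w + act γ.grading w) +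
        (conj (h x))⁻¹ • (1 / 2 : ℂ) • (w - act γ.grading w) := fun w => by
    rw [← γ.act_chiralPos, ← γ.act_chiralNeg]
    rfl
  have h1 : h x ≠ 0 := hh x
  have h2 : conj (h x) ≠ 0 := (map_ne_zero (starRingEnd ℂ)).2 h1
  have hk : ((‖h x‖ ^ 2 : ℝ) : ℂ) = h x * conj (h x) := by
    rw [Complex.mul_conj, Complex.normSq_eq_norm_sq]
  rw [γ.chiralScale_apply, hk]
  simp only [hs, map_add, map_sub, map_smul, map_smulₛₗ, hg, LinearIsometryEquiv.apply_symm_apply,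
    γ.act_grading_grading, map_inv₀, Complex.conj_conj, map_div₀, map_one, Complex.conj_ofNat]
  match_scalars <;> field_simp <;> ring

/-! ### Differentiation of a rescaled spinor -/

section Leibniz

variable {E : Type*} [NormedAddCommGroup E] [NormedSpace ℝ E] {H : Type*} [TopologicalSpace H]
  {I : ModelWithCorners ℝ E H} {M : Type*} [TopologicalSpace M] [ChartedSpace H M]
  {F F' : Type*} [NormedAddCommGroup F] [NormedSpace ℝ F] [NormedAddCommGroup F']
  [NormedSpace ℝ F']

/-- The chain rule for a map `G` between normed spaces after a map `f` on a manifold. -/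
theorem mvfderiv_comp_of_hasFDerivAt {G : F → F'} {G' : F →L[ℝ] F'} {f : M → F} {x : M}
    (hG : HasFDerivAt G G' (f x)) (hf : MDifferentiableAt I 𝓘(ℝ, F) f x)
    (v : TangentSpace I x) :
    mvfderiv I (fun y => G (f y)) x v = G' (mvfderiv I f x v) := by
  have h : mfderiv I 𝓘(ℝ, F') (G ∘ f) x v = _ :=
    mfderiv_comp_apply x hG.differentiableAt.mdifferentiableAt hf v
  have h2 : mfderiv 𝓘(ℝ, F) 𝓘(ℝ, F') G (f x) = G' := by
    rw [mfderiv_eq_fderiv, hG.fderiv]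
  refine h.trans ?_
  simp only [mvfderiv, h2]
  rfl

end Leibniz

section ChiralLeibniz

variable {m : ℕ} {M : Type*} [TopologicalSpace M] [ChartedSpace (Model m) M]

theorem DiracMatrices.chiralScale_apply_real (γ : DiracMatrices m) (t : ℝ) (v : SpinorSpace m) :
    γ.chiralScale t v = t • act γ.chiralPos v + t⁻¹ • act γ.chiralNeg v := by
  simp [chiralScale, ← Complex.coe_smul]

theorem DiracMatrices.contMDiffOn_chiralScale (γ : DiracMatrices m) {k : M → ℝ} {s : Set M}
    (hk : ContMDiff (𝓡 (2 * m)) 𝓘(ℝ, ℝ) ∞ k) (hk0 : ∀ x, k x ≠ 0) {φ : M → SpinorSpace m}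
    (hφ : ContMDiffOn (𝓡 (2 * m)) 𝓘(ℝ, SpinorSpace m) ∞ φ s) :
    ContMDiffOn (𝓡 (2 * m)) 𝓘(ℝ, SpinorSpace m) ∞ (fun y => γ.chiralScale (k y) (φ y)) s := by
  have h1 : ∀ A : SpinMat m, ContMDiffOn (𝓡 (2 * m)) 𝓘(ℝ, SpinorSpace m) ∞
      (fun y => act A (φ y)) s := fun A =>
    ((act A).restrictScalars ℝ).contDiff.contMDiff.comp_contMDiffOn hφ
  have h2 : ContMDiff (𝓡 (2 * m)) 𝓘(ℝ, ℝ) ∞ fun y => (k y)⁻¹ := fun x =>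
    ((contDiffAt_inv ℝ (hk0 x)).contMDiffAt).comp x (hk x)
  simp only [γ.chiralScale_apply_real]
  exact (hk.contMDiffOn.smul (h1 _)).add (h2.contMDiffOn.smul (h1 _))

/-- The Leibniz rule: since `d(k⁻¹) = -k⁻¹ d(ln k)`, differentiating `k (1 + γ)/2 + k⁻¹ (1 - γ)/2`
produces `d(ln k) γ` times the same endomorphism. -/
theorem DiracMatrices.mvfderiv_chiralScale (γ : DiracMatrices m) {k : M → ℝ} {x : M}
    (hk : MDifferentiableAt (𝓡 (2 * m)) 𝓘(ℝ, ℝ) k x) (hk0 : k x ≠ 0) {φ : M → SpinorSpace m}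
    (hφ : MDifferentiableAt (𝓡 (2 * m)) 𝓘(ℝ, SpinorSpace m) φ x)
    (v : TangentSpace (𝓡 (2 * m)) x) :
    mvfderiv (𝓡 (2 * m)) (fun y => γ.chiralScale (k y) (φ y)) x v =
      γ.chiralScale (k x) (mvfderiv (𝓡 (2 * m)) φ x v +
        (differential (fun y => Real.log (k y)) x v : ℂ) • act γ.grading (φ x)) := by
  have hA : ∀ A : SpinMat m, HasFDerivAt (𝕜 := ℝ) (act A) ((act A).restrictScalars ℝ) (φ x) :=
    fun A => ((act A).restrictScalars ℝ).hasFDerivAt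
  have h1 : ∀ A : SpinMat m, MDifferentiableAt (𝓡 (2 * m)) 𝓘(ℝ, SpinorSpace m)
      (fun y => act A (φ y)) x := fun A =>
    (hA A).differentiableAt.comp_mdifferentiableAt hφ
  have hi := (hasDerivAt_inv hk0).hasFDerivAt
  have hl := (Real.hasDerivAt_log hk0).hasFDerivAt
  have h2 : MDifferentiableAt (𝓡 (2 * m)) 𝓘(ℝ, ℝ) (fun y => (k y)⁻¹) x :=
    hi.differentiableAt.comp_mdifferentiableAt hk
  have e1 := mvfderiv_comp_of_hasFDerivAt (hA γ.chiralPos) hφ v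
  have e2 := mvfderiv_comp_of_hasFDerivAt (hA γ.chiralNeg) hφ v
  have e3 := mvfderiv_comp_of_hasFDerivAt hi hk v
  have e4 : differential (fun y => Real.log (k y)) x v = _ := mvfderiv_comp_of_hasFDerivAt hl hk v
  simp only [γ.chiralScale_apply_real (k _) (φ _)]
  have e5 : (fun y => k y • act γ.chiralPos (φ y) + (k y)⁻¹ • act γ.chiralNeg (φ y)) =
      k • (fun y => act γ.chiralPos (φ y)) + (fun y => (k y)⁻¹) • fun y => act γ.chiralNeg (φ y) :=
    rfl
  rw [e5, mvfderiv_add (hk.smul (h1 _)) (h2.smul (h1 _)), mvfderiv_smul hk (h1 _),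
    mvfderiv_smul h2 (h1 _), e4]
  simp only [add_apply, smul_apply,
    ContinuousLinearMap.smulRight_apply, e1, e2, e3]
  generalize mvfderiv (𝓡 (2 * m)) φ x v = w
  generalize mvfderiv (𝓡 (2 * m)) k x v = d
  have hc : ((k x : ℝ) : ℂ) ≠ 0 := Complex.ofReal_ne_zero.2 hk0
  simp only [← Complex.coe_smul, γ.chiralScale_apply, γ.act_chiralPos, γ.act_chiralNeg, map_add,
    map_smul, γ.act_grading_grading, ContinuousLinearMap.coe_restrictScalars',
    ContinuousLinearMap.toSpanSingleton_apply, smul_eq_mul, Complex.ofReal_mul,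
    Complex.ofReal_inv, Complex.ofReal_neg, Complex.ofReal_pow]
  match_scalars <;> field_simp

end ChiralLeibniz

/-! ### The twisted Dirac operator between rescalings -/

namespace SpinStructure

variable {m : ℕ} {M : Type*} [TopologicalSpace M] [ChartedSpace (Model m) M]
  [IsManifold (𝓡 (2 * m)) ∞ M] {g : Metric m M} {γ : DiracMatrices m} (S : SpinStructure g γ)

/-- The spinor field `k (1 + γ)/2 ψ + k⁻¹ (1 - γ)/2 ψ`. The grading commutes with the spin group,
so that this expression has the same form in all the spin frames. -/
def rescale (k : M → ℝ) (ψ : S.SpinorField) : S.SpinorField := fun x => γ.chiralScale (k x) (ψ x)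

theorem mem_chart_idx (x : M) : x ∈ (S.chart (S.idx x)).source := by
  classical
  exact Nat.find_spec (S.cover x)

/-- The cocycle condition makes `s_{kk}` idempotent, and elements of the spin group are
invertible. -/
theorem trans_self {k : ℕ} {x : M} (hx : x ∈ (S.chart k).source) : S.trans k k x = 1 := by
  have h1 := S.trans_cocycle k k k x ⟨⟨hx, hx⟩, hx⟩
  have h2 := γ.isUnit_of_mem_spinGroup (S.trans_mem k k x ⟨hx, hx⟩)
  exact h2.mul_eq_left.1 h1

theorem localRep_idx (ψ : S.SpinorField) (x : M) : S.localRep (S.idx x) ψ x = ψ x := by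
  rw [localRep, S.trans_self (S.mem_chart_idx x), act_one_apply]

theorem localRep_rescale (k : M → ℝ) (ψ : S.SpinorField) {j : ℕ} {y : M}
    (hy : y ∈ (S.chart j).source) :
    S.localRep j (S.rescale k ψ) y = γ.chiralScale (k y) (S.localRep j ψ y) :=
  (γ.chiralScale_act_of_commute
    (γ.commute_grading_of_mem_spinGroup (S.trans_mem _ _ y ⟨hy, S.mem_chart_idx y⟩)) _ _).symm

variable {S} in
theorem IsSmooth.rescale {k : M → ℝ} (hk : ContMDiff (𝓡 (2 * m)) 𝓘(ℝ, ℝ) ∞ k)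
    (hk0 : ∀ x, k x ≠ 0) {ψ : S.SpinorField} (hψ : S.IsSmooth ψ) : S.IsSmooth (S.rescale k ψ) :=
  fun j => (γ.contMDiffOn_chiralScale hk hk0 (hψ j)).congr fun _ hy => S.localRep_rescale k ψ hy

theorem rescale_inv_rescale {k : M → ℝ} (hk0 : ∀ x, k x ≠ 0) (ψ : S.SpinorField) :
    S.rescale (fun x => (k x)⁻¹) (S.rescale k ψ) = ψ :=
  funext fun x => γ.chiralScale_inv_apply' (hk0 x) (ψ x)

theorem commute_grading_spinConnection (j : ℕ) (x : M) (a : Fin (2 * m)) :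
    Commute γ.grading (S.spinConnection j x a) :=
  (Commute.sum_right _ _ _ fun b _ => Commute.sum_right _ _ _ fun c _ =>
    (γ.commute_grading_mat_mul_mat c b).smul_right _).smul_right _

/-- The covariant Leibniz rule for a rescaled spinor. The spin connection drops out, because its
matrices have even degree in the Dirac matrices and so commute with the grading. -/
theorem spinDeriv_rescale {k : M → ℝ} (hk : ContMDiff (𝓡 (2 * m)) 𝓘(ℝ, ℝ) ∞ k)
    (hk0 : ∀ x, k x ≠ 0) {ψ : S.SpinorField} (hψ : S.IsSmooth ψ) (x : M) (a : Fin (2 * m)) :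
    S.spinDeriv (S.rescale k ψ) x a = γ.chiralScale (k x) (S.spinDeriv ψ x a +
      (differential (fun y => Real.log (k y)) x (S.frame (S.idx x) a x) : ℂ) •
        act γ.grading (ψ x)) := by
  have hn : (S.chart (S.idx x)).source ∈ nhds x :=
    (S.chart (S.idx x)).open_source.mem_nhds (S.mem_chart_idx x)
  have he : S.localRep (S.idx x) (S.rescale k ψ) =ᶠ[nhds x]
      fun y => γ.chiralScale (k y) (S.localRep (S.idx x) ψ y) :=
    Filter.mem_of_superset hn fun y hy => S.localRep_rescale k ψ hy
  have hd : MDifferentiableAt (𝓡 (2 * m)) 𝓘(ℝ, SpinorSpace m) (S.localRep (S.idx x) ψ) x :=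
    ((hψ (S.idx x)).contMDiffAt hn).mdifferentiableAt (by simp)
  have hkx : MDifferentiableAt (𝓡 (2 * m)) 𝓘(ℝ, ℝ) k x := (hk x).mdifferentiableAt (by simp)
  -- The derivatives `mfderiv` of two functions have different types, as the target tangent space
  -- depends on the value; the congruence is taken in the model space, where the types agree.
  have e1 : mvfderiv (𝓡 (2 * m)) (S.localRep (S.idx x) (S.rescale k ψ)) x
        (S.frame (S.idx x) a x) =
      mvfderiv (𝓡 (2 * m)) (fun y => γ.chiralScale (k y) (S.localRep (S.idx x) ψ y)) x
        (S.frame (S.idx x) a x) := by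
    have h2 : mfderiv (𝓡 (2 * m)) 𝓘(ℝ, SpinorSpace m) (S.localRep (S.idx x) (S.rescale k ψ)) x =
      mfderiv (𝓡 (2 * m)) 𝓘(ℝ, SpinorSpace m)
        (fun y => γ.chiralScale (k y) (S.localRep (S.idx x) ψ y)) x := he.mfderiv_eq
    exact congrArg (fun L : Model m →L[ℝ] SpinorSpace m => L (S.frame (S.idx x) a x)) h2
  rw [spinDeriv, e1, γ.mvfderiv_chiralScale hkx (hk0 x) hd, S.localRep_idx, rescale,
    ← γ.chiralScale_act_of_commute (S.commute_grading_spinConnection _ x a), ← map_add, spinDeriv]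
  congr 1
  abel

/-- The rescaling leaves the torsion term invariant: moved through `γ^a`, one factor becomes the
inverse of the other. -/
theorem rescale_torsionTerm_rescale {k : M → ℝ} (hk0 : ∀ x, k x ≠ 0)
    (ωf : ∀ x : M, TangentSpace (𝓡 (2 * m)) x →L[ℝ] ℝ) (ψ : S.SpinorField) :
    S.rescale k (S.torsionTerm ωf (S.rescale k ψ)) = S.torsionTerm ωf ψ := by
  funext x
  simp only [rescale, torsionTerm, map_smul, map_sum, act_mul_apply, γ.chiralScale_act_mat,
    ← γ.chiralScale_act_of_commute (Commute.refl γ.grading), γ.chiralScale_inv_apply' (hk0 x)]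

/-- On smooth spinors, the rescaling by `k` turns `∂̸_ω` into `∂̸_{ω + d(ln k)}`: the factor moved
through `γ^a` cancels the one coming out of the Leibniz rule, and what is left of the derivative of
`k` is the torsion term of `d(ln k)`. -/
theorem rescale_twistedDirac_rescale {k : M → ℝ} (hk : ContMDiff (𝓡 (2 * m)) 𝓘(ℝ, ℝ) ∞ k)
    (hk0 : ∀ x, k x ≠ 0) (ωf : ∀ x : M, TangentSpace (𝓡 (2 * m)) x →L[ℝ] ℝ)
    {ψ : S.SpinorField} (hψ : S.IsSmooth ψ) :
    S.rescale k (S.twistedDirac ωf (S.rescale k ψ)) =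
      S.twistedDirac (fun x => ωf x + differential (fun y => Real.log (k y)) x) ψ := by
  funext x
  have h1 := congrFun (S.rescale_torsionTerm_rescale hk0 ωf ψ) x
  have h2 : γ.chiralScale (k x) (S.dirac (S.rescale k ψ) x) = S.dirac ψ x +
      S.torsionTerm (fun x => differential (fun y => Real.log (k y)) x) ψ x := by
    simp only [dirac, torsionTerm, map_smul, map_sum, γ.chiralScale_act_mat,
      S.spinDeriv_rescale hk hk0 hψ, γ.chiralScale_inv_apply' (hk0 x), map_add, act_mul_apply,
      Finset.sum_add_distrib, smul_add]
  have h3 : S.torsionTerm (fun x => ωf x + differential (fun y => Real.log (k y)) x) ψ x =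
      S.torsionTerm ωf ψ x +
        S.torsionTerm (fun x => differential (fun y => Real.log (k y)) x) ψ x := by
    simp only [torsionTerm, add_apply, Complex.ofReal_add, add_smul,
      Finset.sum_add_distrib, smul_add]
  rw [twistedDirac, h3, ← h1]
  simp only [rescale, twistedDirac, map_add] at h2 ⊢
  rw [h2]
  abel

end SpinStructure

/-! ### Conjugation of closures of operators -/

section Conjugation

variable {H : Type*} [NormedAddCommGroup H] [InnerProductSpace ℂ H] [CompleteSpace H]

/-- Conjugation by an invertible selfadjoint `T` moves the graph of an operator by
`(x, y) ↦ (T⁻¹ x, T y)`. This also covers submodules that are not graphs: both sides then vanish on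
the same domain, by the convention of `Submodule.toLinearPMap`. -/
theorem conjugateAction_toLinearPMap {T T' : H →L[ℂ] H}
    (hT : ContinuousLinearMap.adjoint T = T) (h1 : ∀ x, T (T' x) = x) (h2 : ∀ x, T' (T x) = x)
    {G G' : Submodule ℂ (H × H)} (hG : ∀ p, p ∈ G' ↔ (T p.1, T' p.2) ∈ G) :
    conjugateAction T G.toLinearPMap = G'.toLinearPMap := by
  have hG2 : ∀ x y, (T x, y) ∈ G → (x, T y) ∈ G' := fun x y h => (hG _).2 (by simpa [h2] using h)
  have hdom : (conjugateAction T G.toLinearPMap).domain = G'.toLinearPMap.domain := by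
    ext x
    simp only [conjugateAction, Submodule.toLinearPMap_domain, Submodule.mem_comap,
      ContinuousLinearMap.coe_coe, hT, Submodule.mem_map, LinearMap.fst_apply]
    constructor
    · rintro ⟨⟨a, b⟩, hp, rfl : a = T x⟩
      exact ⟨(x, T b), hG2 x b hp, rfl⟩
    · rintro ⟨p, hp, rfl⟩
      exact ⟨_, (hG p).1 hp, rfl⟩
  refine LinearPMap.ext hdom fun x hx hx' => ?_
  have hTx : T x ∈ G.toLinearPMap.domain := by
    have h : ContinuousLinearMap.adjoint T x ∈ G.toLinearPMap.domain := hx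
    rwa [hT] at h
  have hval : (conjugateAction T G.toLinearPMap) ⟨x, hx⟩ = T (G.toLinearPMap ⟨T x, hTx⟩) := by
    change T (G.toLinearPMap ⟨ContinuousLinearMap.adjoint T x, hx⟩) = _
    congr 3
    rw [hT]
  rw [hval]
  by_cases hs : ∀ p : H × H, p ∈ G → p.1 = 0 → p.2 = 0
  · have hs' : ∀ p : H × H, p ∈ G' → p.1 = 0 → p.2 = 0 := fun p hp h0 => by
      have h3 := hs _ ((hG p).1 hp) (by simp [h0])
      rw [← h1 p.2]
      simp only at h3
      rw [h3, map_zero]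
    have m1 := Submodule.mem_graph_toLinearPMap hs ⟨T x, hTx⟩
    have m2 := Submodule.mem_graph_toLinearPMap hs' ⟨x, hx'⟩
    have m3 := G'.sub_mem (hG2 x _ m1) m2
    exact sub_eq_zero.1 (hs' _ m3 (sub_self x))
  · have hs' : ¬ ∀ p : H × H, p ∈ G' → p.1 = 0 → p.2 = 0 := fun h => hs fun p hp h0 => by
      have h3 := h (T' p.1, T p.2) ((hG _).2 (by simpa [h1, h2] using hp)) (by simp [h0])
      rw [← h2 p.2]
      simp only at h3
      rw [h3, map_zero]
    have z1 : G.toLinearPMap ⟨T x, hTx⟩ = 0 := by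
      have h : G.toLinearPMap.toFun = 0 := dif_neg hs
      exact congrArg (fun L => L ⟨T x, hTx⟩) h
    have z2 : G'.toLinearPMap ⟨x, hx'⟩ = 0 := by
      have h : G'.toLinearPMap.toFun = 0 := dif_neg hs'
      exact congrArg (fun L => L ⟨x, hx'⟩) h
    rw [z1, z2, map_zero]

theorem mem_topologicalClosure_span_of_mapsTo {E : Type*} [AddCommGroup E] [Module ℂ E]
    [TopologicalSpace E] [ContinuousAdd E] [ContinuousConstSMul ℂ E] (Φ : E →L[ℂ] E) {A B : Set E}
    (h : Set.MapsTo Φ A B) {p : E} (hp : p ∈ (Submodule.span ℂ A).topologicalClosure) :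
    Φ p ∈ (Submodule.span ℂ B).topologicalClosure := by
  have h1 : Submodule.span ℂ A ≤ (Submodule.span ℂ B).comap (Φ : E →ₗ[ℂ] E) :=
    Submodule.span_le.2 fun a ha => Submodule.subset_span (h ha)
  exact map_mem_closure Φ.continuous hp fun a ha => h1 ha

end Conjugation

/-! ### The adjoint action on square integrable spinors -/

namespace SpinStructure

variable {m : ℕ} {M : Type*} [TopologicalSpace M] [ChartedSpace (Model m) M]
  [IsManifold (𝓡 (2 * m)) ∞ M] {g : Metric m M} {γ : DiracMatrices m} (S : SpinStructure g γ)
  [CompactSpace M] [MeasurableSpace M] [BorelSpace M]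

theorem coeFn_rep (a : TwistAlgebra m M) (ψ : S.L2) :
    S.rep a ψ =ᵐ[S.vol] fun x => symbol γ a x (ψ x) := by
  have h1 := (ContinuousLinearMap.id ℂ (SpinorSpace m →L[ℂ] SpinorSpace m)).coeFn_holder (r := 2)
    ((memLp_symbol γ a S.vol).toLp _) ψ
  filter_upwards [h1, (memLp_symbol γ a S.vol).coeFn_toLp] with x h2 h3
  rw [h3] at h2
  exact h2

/-- `Ad(u_h)` acts on square integrable spinors as the pointwise rescaling by `|h|²`. -/
theorem coeFn_Ad (hm : Even m) (c : ChargeConjugation γ) (h : SmoothFun m M) (hh : ∀ x, h x ≠ 0)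
    (ψ : S.L2) :
    S.Ad c (twistedUnitary h hh) ψ =ᵐ[S.vol] S.rescale (fun x => ‖h x‖ ^ 2) ψ := by
  have hJ : ∀ (L : SpinorSpace m ≃ₗᵢ⋆[ℂ] SpinorSpace m) (φ : S.L2),
      S.antilinearOp L φ =ᵐ[S.vol] fun x => L (φ x) := fun L φ =>
    ContinuousLinearMap.coeFn_compLpL
      (L.toContinuousLinearEquiv : SpinorSpace m →SL[starRingEnd ℂ] SpinorSpace m) φ
  filter_upwards [S.coeFn_rep (twistedUnitary h hh).1
      (S.antilinearOp c.fibre (S.rep (twistedUnitary h hh).1 (S.antilinearOp c.fibre.symm ψ))),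
    hJ c.fibre (S.rep (twistedUnitary h hh).1 (S.antilinearOp c.fibre.symm ψ)),
    S.coeFn_rep (twistedUnitary h hh).1 (S.antilinearOp c.fibre.symm ψ),
    hJ c.fibre.symm ψ] with x h1 h2 h3 h4
  rw [h2, h3, h4, c.symbol_fibre_symbol hm h hh] at h1
  exact h1

theorem adjoint_Ad (hm : Even m) (c : ChargeConjugation γ) (h : SmoothFun m M)
    (hh : ∀ x, h x ≠ 0) :
    ContinuousLinearMap.adjoint (S.Ad c (twistedUnitary h hh)) = S.Ad c (twistedUnitary h hh) := by
  refine ((ContinuousLinearMap.eq_adjoint_iff _ _).2 fun ψ φ => ?_).symm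
  rw [L2.inner_def, L2.inner_def]
  refine integral_congr_ae ?_
  filter_upwards [S.coeFn_Ad hm c h hh ψ, S.coeFn_Ad hm c h hh φ] with x h1 h2
  rw [h1, h2]
  exact γ.inner_chiralScale_left _ _ _

theorem Ad_Ad_of_mul_eq_one (hm : Even m) (c : ChargeConjugation γ) (h h' : SmoothFun m M)
    (hh : ∀ x, h x ≠ 0) (hh' : ∀ x, h' x ≠ 0) (hmul : ∀ x, h x * h' x = 1) (ψ : S.L2) :
    S.Ad c (twistedUnitary h hh) (S.Ad c (twistedUnitary h' hh') ψ) = ψ := by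
  ext1
  filter_upwards [S.coeFn_Ad hm c h hh (S.Ad c (twistedUnitary h' hh') ψ),
    S.coeFn_Ad hm c h' hh' ψ] with x h1 h2
  have h3 : ‖h' x‖ ^ 2 = (‖h x‖ ^ 2)⁻¹ := by
    rw [eq_inv_of_mul_eq_one_right (hmul x), norm_inv, inv_pow]
  rw [h1, rescale, h2, rescale, h3]
  exact γ.chiralScale_inv_apply (pow_ne_zero 2 (norm_ne_zero_iff.2 (hh x))) _

/-- If the rescaling by `|h|²` intertwines the differential operators `P` and `P'` on smooth
spinors, then `Ad(u_h)` conjugates the closure of `P` to the closure of `P'`. -/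
theorem conjugateAction_realize (hm : Even m) (c : ChargeConjugation γ) (h : SmoothFun m M)
    (hh : ∀ x, h x ≠ 0) {P P' : S.SpinorField → S.SpinorField}
    (hP : ∀ ψ, S.IsSmooth ψ → S.rescale (fun x => ‖h x‖ ^ 2)
      (P (S.rescale (fun x => ‖h x‖ ^ 2) ψ)) = P' ψ) :
    conjugateAction (S.Ad c (twistedUnitary h hh)) (S.realize P) = S.realize P' := by
  have hi0 : ∀ x, invFun h hh x ≠ 0 := fun x => inv_ne_zero (hh x)
  have hk0 : ∀ x, ‖h x‖ ^ 2 ≠ 0 := fun x => pow_ne_zero 2 (norm_ne_zero_iff.2 (hh x))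
  have hk : ContMDiff (𝓡 (2 * m)) 𝓘(ℝ, ℝ) ∞ fun x => ‖h x‖ ^ 2 :=
    (contDiff_norm_sq ℝ (E := ℂ)).contMDiff.comp h.contMDiff
  have hki : ContMDiff (𝓡 (2 * m)) 𝓘(ℝ, ℝ) ∞ fun x => (‖h x‖ ^ 2)⁻¹ := fun x =>
    ((contDiffAt_inv ℝ (hk0 x)).contMDiffAt).comp x (hk x)
  have hinv : ∀ x, ‖invFun h hh x‖ ^ 2 = (‖h x‖ ^ 2)⁻¹ := fun x => by
    rw [← inv_pow, ← norm_inv]; rfl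
  set T := S.Ad c (twistedUnitary h hh)
  set T' := S.Ad c (twistedUnitary (invFun h hh) hi0)
  have h1 : ∀ ψ, T (T' ψ) = ψ :=
    S.Ad_Ad_of_mul_eq_one hm c h (invFun h hh) hh hi0 fun x => mul_inv_cancel₀ (hh x)
  have h2 : ∀ ψ, T' (T ψ) = ψ :=
    S.Ad_Ad_of_mul_eq_one hm c (invFun h hh) h hi0 hh fun x => inv_mul_cancel₀ (hh x)
  have hT : ∀ (p : S.L2) (ψ : S.SpinorField), p =ᵐ[S.vol] ψ →
      T p =ᵐ[S.vol] S.rescale (fun x => ‖h x‖ ^ 2) ψ := fun p ψ hp => by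
    filter_upwards [S.coeFn_Ad hm c h hh p, hp] with x e1 e2
    rw [e1, rescale, e2, rescale]
  have hT' : ∀ (p : S.L2) (ψ : S.SpinorField), p =ᵐ[S.vol] ψ →
      T' p =ᵐ[S.vol] S.rescale (fun x => (‖h x‖ ^ 2)⁻¹) ψ := fun p ψ hp => by
    filter_upwards [S.coeFn_Ad hm c (invFun h hh) hi0 p, hp] with x e1 e2
    rw [e1, rescale, e2, rescale, hinv]
  have hri : ∀ ψ, S.rescale (fun x => ‖h x‖ ^ 2) (S.rescale (fun x => (‖h x‖ ^ 2)⁻¹) ψ) = ψ :=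
    fun ψ => funext fun x => γ.chiralScale_inv_apply (hk0 x) (ψ x)
  refine conjugateAction_toLinearPMap (T' := T') (S.adjoint_Ad hm c h hh) h1 h2
    fun p => ⟨fun hp => ?_, fun hp => ?_⟩
  · refine mem_topologicalClosure_span_of_mapsTo (T.prodMap T') ?_ hp
    rintro q ⟨ψ, hψ, e1, e2⟩
    refine ⟨S.rescale (fun x => ‖h x‖ ^ 2) ψ, hψ.rescale hk hk0, hT _ _ e1, ?_⟩
    rw [← hP ψ hψ] at e2
    have e3 := hT' _ _ e2
    rwa [S.rescale_inv_rescale hk0] at e3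
  · have hp' : p = T'.prodMap T (T p.1, T' p.2) := by
      simp [h1, h2]
    rw [hp']
    refine mem_topologicalClosure_span_of_mapsTo (T'.prodMap T) ?_ hp
    rintro q ⟨ψ, hψ, e1, e2⟩
    have hs : S.IsSmooth (S.rescale (fun x => (‖h x‖ ^ 2)⁻¹) ψ) :=
      hψ.rescale hki fun x => inv_ne_zero (hk0 x)
    refine ⟨S.rescale (fun x => (‖h x‖ ^ 2)⁻¹) ψ, hs, hT' _ _ e1, ?_⟩
    rw [← hP _ hs, hri]
    exact hT _ _ e2

end SpinStructure

end TwistedSpin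

end

open TwistedSpin in
theorem mainTheorem5 {m : ℕ} {M : Type*} [TopologicalSpace M] [T2Space M] [CompactSpace M]
    [ChartedSpace (EuclideanSpace ℝ (Fin (2 * m))) M] [IsManifold (𝓡 (2 * m)) ∞ M]
    [MeasurableSpace M] [BorelSpace M]
    (hKO : koDimension m = 0 ∨ koDimension m = 4)
    (g : Metric m M) (γ : DiracMatrices m) (c : ChargeConjugation γ) (S : SpinStructure g γ)
    (ωf : ∀ x : M, TangentSpace (𝓡 (2 * m)) x →L[ℝ] ℝ) (hω : IsSmoothForm ωf)
    (h : SmoothFun m M) (hh : ∀ x, h x ≠ 0) :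
    conjugateAction (S.Ad c (twistedUnitary h hh)) (S.realize (S.torsionTerm ωf)) =
        S.realize (S.torsionTerm ωf) ∧
      conjugateAction (S.Ad c (twistedUnitary h hh)) (S.realize (S.twistedDirac ωf)) =
        S.realize (S.twistedDirac fun x => ωf x + differential (fun y => Real.log (‖h y‖ ^ 2)) x) := by
  have hm : Even m := by
    rw [Nat.even_iff]
    unfold koDimension at hKO
    omega
  have hk0 : ∀ x, ‖h x‖ ^ 2 ≠ 0 := fun x => pow_ne_zero 2 (norm_ne_zero_iff.2 (hh x))
  have hk : ContMDiff (𝓡 (2 * m)) 𝓘(ℝ, ℝ) ∞ fun x => ‖h x‖ ^ 2 :=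
    (contDiff_norm_sq ℝ (E := ℂ)).contMDiff.comp h.contMDiff
  exact ⟨S.conjugateAction_realize hm c h hh fun ψ _ => S.rescale_torsionTerm_rescale hk0 ωf ψ,
    S.conjugateAction_realize hm c h hh fun ψ hψ =>
      S.rescale_twistedDirac_rescale hk hk0 ωf hψ⟩
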